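/- Let $T\ge 0$, $L_f>0$, $L_s\ge 0$. Let $f:[0,T]\times\mathbb{R}^n\to\mathbb{R}^n$ satisfy $|f(t,x)|\le L_f(1+|x|)$ and $|f(t,x_1)-f(t,x_2)|\le L_f|x_1-x_2|$ for all $t\in[0,T]$ and $x,x_1,x_2\in\mathbb{R}^n$, where $|\cdot|$ is the Euclidean norm. Let $S:[0,T]\rightrightarrows\mathbb{R}^n$ have closed convex values with $d_H(S(t),S(s))\le L_s|t-s|$ for all $s,t\in[0,T]$, where $d_H$ is the Hausdorff distance. For $x_0\in S(0)$ consider * the sweeping process $\dot x(t)\in f(t,x(t))-\mathcal N_{S(t)}(x(t))$, $x(0)=x_0$, where $\mathcal N_{S(t)}(x)$ is the outward normal cone of convex analysis (empty if $x\notin S(t)$); * for $\lambda>0$, its Moreau–Yosida regularization $\dot x^\lambda(t)=f(t,x^\lambda(t))-\frac1\lambda\bigl(x^\lambda(t)-\mathrm{proj}(x^\lambda(t),S(t))\bigr)$, $x^\lambda(0)=x_0$, where $\mathrm{proj}(\cdot,S(t))$ is the Euclidean projection onto $S(t)$. Solutions are absolutely continuous on $[0,T]$ and satisfy the relation for almost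 every $t$. Let $X_t$ and $X^\lambda_t$ be the flow maps of the two systems on $S(0)$, that is, $t\mapsto X_t(x_0)$ and $t\mapsto X_t^\lambda(x_0)$ are solutions of the first and of the second problem for every $x_0\in S(0)$. Let $\mu_0$ be a Borel probability measure on $\mathbb{R}^n$ with $\mu_0(\mathbb{R}^n\setminus S(0))=0$, and put $\mu_t=(X_t)_\#\mu_0$, $\mu^\lambda_t=(X^\lambda_t)_\#\mu_0$. Let $W_1(\mu,\nu)=\inf_\theta\int|x-y|\,d\theta(x,y)\in[0,\infty]$ be the 1-Wasserstein distance, the infimum being over all couplings $\theta$ of $\mu$ and $\nu$, and put $$\kappa=(e^{2L_fT}-1)\,\frac{2L_f+L_s}{2L_f},\qquad C_1=L_f(1+\kappa)+L_s .$$ Then for every $\lambda>0$ and every $t\in[0,T]$: 1. for every $x_0\in S(0)$, $$|X^\lambda_t(x_0)-X_t(x_0)|\le\bigl(L_f(1+\kappa+|x_0|)+L_s\bigr)\sqrt{\frac{\lambda(e^{2L_ft}-1)}{2L_f}};$$ 2. $$W_1(\mu_t,\mu^\lambda_t)\le\Bigl(C_1+L_f\int_{S(0)}|x_0|\,d\mu_0(x_0)\Bigr)\sqrt{\frac{\lambda(e^{2L_ft}-1)}{2L_f}};$$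 3. $$W_1(\mu_t,\mu^\lambda_t)\le\Bigl(C_1+L_fe^{2L_fT}\int_{S(0)}|x_0|\,d\mu_0(x_0)\Bigr)\sqrt{\frac{\lambda(e^{L_ft}-1)}{2L_f}}.$$ (The bounds in 2 and 3 are inequalities in $[0,\infty]$, with $\infty\cdot 0=0$; the first moment of $\mu_0$ may be infinite.) -/

import Mathlib

open Set MeasureTheory
open scoped ENNReal

noncomputable section

/-- `ℝⁿ` with the Euclidean norm. -/
abbrev Euc (n : ℕ) : Type := EuclideanSpace ℝ (Fin n)

/-- The outward normal cone to the convex set `K` at `x`; it is empty when `x ∉ K`. -/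
def normalCone {n : ℕ} (K : Set (Euc n)) (x : Euc n) : Set (Euc n) :=
  {v | x ∈ K ∧ ∀ y ∈ K, inner ℝ v (y - x) ≤ 0}

/-- The Euclidean projection of `x` onto `K`: a point of `K` nearest to `x`.
It exists and is unique when `K` is nonempty, closed and convex (see the two facts below). -/
def metricProj {n : ℕ} (K : Set (Euc n)) (x : Euc n) : Euc n :=
  Classical.epsilon fun p => p ∈ K ∧ ∀ q ∈ K, dist x p ≤ dist x q

theorem metricProj_spec {n : ℕ} {K : Set (Euc n)} (hK : IsClosed K) (hne : K.Nonempty)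
    (x : Euc n) : metricProj K x ∈ K ∧ ∀ q ∈ K, dist x (metricProj K x) ≤ dist x q := by
  obtain ⟨p, hp, hd⟩ := hK.exists_infDist_eq_dist hne x
  have h : ∃ p, p ∈ K ∧ ∀ q ∈ K, dist x p ≤ dist x q :=
    ⟨p, hp, fun q hq => hd ▸ Metric.infDist_le_dist_of_mem hq⟩
  exact Classical.epsilon_spec h

theorem nearest_point_unique {n : ℕ} {K : Set (Euc n)} (hK : Convex ℝ K) (x p p' : Euc n)
    (hp : p ∈ K ∧ ∀ q ∈ K, dist x p ≤ dist x q)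
    (hp' : p' ∈ K ∧ ∀ q ∈ K, dist x p' ≤ dist x q) : p = p' := by
  have hm : (1 / 2 : ℝ) • p + (1 / 2 : ℝ) • p' ∈ K :=
    hK hp.1 hp'.1 (by norm_num) (by norm_num) (by norm_num)
  have h1 := hp.2 _ hm
  have h2 := hp'.2 _ hp.1
  have h3 := hp.2 _ hp'.1
  simp only [dist_eq_norm] at h1 h2 h3
  have e : x - ((1 / 2 : ℝ) • p + (1 / 2 : ℝ) • p') = (1 / 2 : ℝ) • ((x - p) + (x - p')) := by
    module
  have e' : p' - p = (x - p) - (x - p') := by abel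
  rw [e, norm_smul] at h1
  norm_num at h1
  have hpar := parallelogram_law_with_norm ℝ (x - p) (x - p')
  rw [← e'] at hpar
  have h4 : ‖x - p‖ = ‖x - p'‖ := le_antisymm h3 h2
  have h5 : 2 * ‖x - p‖ ≤ ‖x - p + (x - p')‖ := by linarith
  have h6 : ‖p' - p‖ * ‖p' - p‖ ≤ 0 := by
    rw [← h4] at hpar
    nlinarith [norm_nonneg (x - p)]
  have h7 : ‖p' - p‖ = 0 := by nlinarith [norm_nonneg (p' - p)]
  exact (sub_eq_zero.mp (norm_eq_zero.mp h7)).symm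

/-- `x` is an absolutely continuous solution on `[0,T]` of the sweeping process
`x'(t) ∈ f(t, x(t)) - N_{S(t)}(x(t))` (for almost every `t`), `x(0) = x₀`. -/
def IsSweepingSolution {n : ℕ} (f : ℝ → Euc n → Euc n) (S : ℝ → Set (Euc n)) (T : ℝ)
    (x₀ : Euc n) (x : ℝ → Euc n) : Prop :=
  AbsolutelyContinuousOnInterval x 0 T ∧ x 0 = x₀ ∧
    ∀ᵐ t ∂(volume.restrict (Icc 0 T)),
      ∃ v ∈ normalCone (S t) (x t), HasDerivAt x (f t (x t) - v) t

/-- `x` is an absolutely continuous solution on `[0,T]` of the Moreau-Yosida regularized equation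
`x'(t) = f(t, x(t)) - (1/lam) (x(t) - proj(x(t), S(t)))` (for almost every `t`), `x(0) = x₀`. -/
def IsRegularizedSolution {n : ℕ} (f : ℝ → Euc n → Euc n) (S : ℝ → Set (Euc n)) (T lam : ℝ)
    (x₀ : Euc n) (x : ℝ → Euc n) : Prop :=
  AbsolutelyContinuousOnInterval x 0 T ∧ x 0 = x₀ ∧
    ∀ᵐ t ∂(volume.restrict (Icc 0 T)),
      HasDerivAt x (f t (x t) - (1 / lam) • (x t - metricProj (S t) (x t))) t

/-- `X t x₀` is the value at time `t` of the solution of the sweeping process that starts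
from `x₀ ∈ S(0)`. -/
def IsSweepingFlow {n : ℕ} (f : ℝ → Euc n → Euc n) (S : ℝ → Set (Euc n)) (T : ℝ)
    (X : ℝ → Euc n → Euc n) : Prop :=
  ∀ x₀ ∈ S 0, IsSweepingSolution f S T x₀ fun t => X t x₀

/-- `X t x₀` is the value at time `t` of the solution of the regularized equation that starts
from `x₀ ∈ S(0)`. -/
def IsRegularizedFlow {n : ℕ} (f : ℝ → Euc n → Euc n) (S : ℝ → Set (Euc n)) (T lam : ℝ)
    (X : ℝ → Euc n → Euc n) : Prop :=
  ∀ x₀ ∈ S 0, IsRegularizedSolution f S T lam x₀ fun t => X t x₀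

/-- The 1-Wasserstein distance (Kantorovich formulation), with values in `[0, ∞]`. -/
def wasserstein1 {n : ℕ} (μ ν : Measure (Euc n)) : ℝ≥0∞ :=
  ⨅ θ ∈ {θ : Measure (Euc n × Euc n) | θ.map Prod.fst = μ ∧ θ.map Prod.snd = ν},
    ∫⁻ p, ‖p.1 - p.2‖ₑ ∂θ

/-- `κ = (e^{2 L_f T} - 1) (2 L_f + L_s) / (2 L_f)`. -/
def sweepKappa (Lf Ls T : ℝ) : ℝ :=
  (Real.exp (2 * Lf * T) - 1) * ((2 * Lf + Ls) / (2 * Lf))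

/-- `C₁ = L_f (1 + κ) + L_s`. -/
def sweepC1 (Lf Ls T : ℝ) : ℝ := Lf * (1 + sweepKappa Lf Ls T) + Ls

end

/-! Let x solve the sweeping process, y the regularized equation, z = y - x, and let v be the normal
vector in x' = f - v. The Lipschitz bound on f and the convexity of S(t) give (|z|²)' ≤ 2L_f|z|² +
(λ/2)|v|² (`inner_penalty_normalCone_le`). By Gronwall it remains to bound ∫ e^{-2L_f s}|v|² ds
independently of λ, whence the rate √λ.

The Lipschitz motion of S gives ⟨v, x'⟩ ≥ -L_s|v| (`neg_le_inner_deriv`). With F = L_f(1+|x|) and r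
= |x| this yields |v| ≤ F + L_s and |v|² ≤ F² - r'² + 2L_s|v|. The first bound suffices for the rate
with e^{L_f t} (`norm_sq_sub_le_linear`). It is too weak for the pointwise estimate, where |x₀|
carries only the factor L_f; there the term -r'² is kept (`norm_sq_sub_le_quadratic`): velocity
spent on increasing |x| is not available to v.

The push-forward of μ₀ by the pair of flows is a coupling, so pointwise bounds integrate to bounds
on W₁. -/

open Filter Topology

/-! ### Absolutely continuous functions and an energy Gronwall inequality. -/

section AbsolutelyContinuous

variable {E : Type*} [NormedAddCommGroup E]

theorem AbsolutelyContinuousOnInterval.norm_comp {x : ℝ → E} {a b : ℝ}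
    (hx : AbsolutelyContinuousOnInterval x a b) :
    AbsolutelyContinuousOnInterval (fun t => ‖x t‖) a b := by
  refine squeeze_zero (fun I => Finset.sum_nonneg fun i _ => dist_nonneg) (fun I => ?_) hx
  refine Finset.sum_le_sum fun i _ => ?_
  rw [dist_eq_norm (x _)]
  exact dist_norm_norm_le _ _

theorem AbsolutelyContinuousOnInterval.of_contDiff {g : ℝ → ℝ} (hg : ContDiff ℝ 1 g) (a b : ℝ) :
    AbsolutelyContinuousOnInterval g a b := by
  obtain ⟨K, hK⟩ := hg.contDiffOn.exists_lipschitzOnWith (s := uIcc a b) (by norm_num)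
    (convex_uIcc a b) isCompact_uIcc
  exact hK.absolutelyContinuousOnInterval

theorem AbsolutelyContinuousOnInterval.le_of_ae_hasDerivAt_nonpos {g : ℝ → ℝ} {a b : ℝ}
    (hab : a ≤ b) (hg : AbsolutelyContinuousOnInterval g a b)
    (h : ∀ᵐ s ∂volume.restrict (Icc a b), ∃ d ≤ 0, HasDerivAt g d s) : g b ≤ g a := by
  have h1 := hg.integral_deriv_eq_sub
  have h2 : 0 ≤ ∫ s in a..b, -deriv g s := by
    refine intervalIntegral.integral_nonneg_of_ae_restrict hab ?_
    filter_upwards [h] with s ⟨d, hd, hs⟩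
    simp [hs.deriv, hd]
  rw [intervalIntegral.integral_neg, h1] at h2
  linarith

variable [NormedSpace ℝ E]

theorem HasDerivAt.abs_le_of_norm {x : ℝ → E} {x' : E} {r' t : ℝ} (hx : HasDerivAt x x' t)
    (hr : HasDerivAt (fun s => ‖x s‖) r' t) : |r'| ≤ ‖x'‖ := by
  rw [hasDerivAt_iff_tendsto_slope] at hx hr
  refine le_of_tendsto_of_tendsto hr.abs hx.norm (Eventually.of_forall fun s => ?_)
  simp only [slope, vsub_eq_sub, smul_eq_mul, abs_mul, norm_smul, Real.norm_eq_abs]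
  exact mul_le_mul_of_nonneg_left (abs_norm_sub_norm_le _ _) (abs_nonneg _)

end AbsolutelyContinuous

/-- A Gronwall inequality in energy form. -/
theorem exp_mul_norm_sq_sub_le {E : Type*} [NormedAddCommGroup E] [InnerProductSpace ℝ E]
    {z : ℝ → E} {G : ℝ → ℝ} {t L : ℝ} (ht : 0 ≤ t)
    (hz : AbsolutelyContinuousOnInterval z 0 t) (hG : AbsolutelyContinuousOnInterval G 0 t)
    (h : ∀ᵐ s ∂volume.restrict (Icc 0 t), ∃ z' g', HasDerivAt z z' s ∧ HasDerivAt G g' s ∧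
      2 * inner ℝ (z s) z' ≤ 2 * L * ‖z s‖ ^ 2 + Real.exp (L * s) ^ 2 * g') :
    (Real.exp (L * t) ^ 2)⁻¹ * ‖z t‖ ^ 2 - ‖z 0‖ ^ 2 ≤ G t - G 0 := by
  have hexp : ∀ s, (Real.exp (L * s) ^ 2)⁻¹ = Real.exp (-(2 * L) * s) := fun s => by
    rw [← Real.exp_nat_mul, ← Real.exp_neg]; congr 1; push_cast; ring
  -- `G` serves as an antiderivative dominating the weighted source, so the source is never
  -- integrated and the selected normal vectors need not be measurable.
  have hac : AbsolutelyContinuousOnInterval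
      (fun s => Real.exp (-(2 * L) * s) * (‖z s‖ * ‖z s‖) - G s) 0 t :=
    (((AbsolutelyContinuousOnInterval.of_contDiff (by fun_prop) 0 t).fun_mul
      (hz.norm_comp.fun_mul hz.norm_comp))).fun_sub hG
  have := hac.le_of_ae_hasDerivAt_nonpos ht (by
    filter_upwards [h] with s ⟨z', g', hz', hg', hle⟩
    have h1 : HasDerivAt (fun s => Real.exp (-(2 * L) * s))
        (Real.exp (-(2 * L) * s) * (-(2 * L))) s := by
      simpa using ((hasDerivAt_id s).const_mul (-(2 * L))).exp
    have h2 := (h1.mul hz'.norm_sq).sub hg'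
    refine ⟨_, ?_, h2.congr_of_eventuallyEq (Eventually.of_forall fun s => ?_)⟩
    · rw [← hexp]
      have hp := pow_pos (Real.exp_pos (L * s)) 2
      set q := Real.exp (L * s) ^ 2
      have h3 := mul_le_mul_of_nonneg_left hle (inv_pos.2 hp).le
      rw [mul_add, inv_mul_cancel_left₀ hp.ne'] at h3
      linarith
    · simp [sq])
  rw [hexp]
  simp only [mul_zero, Real.exp_zero, one_mul, ← sq] at this
  linarith

/-! ### Projections and normal cones of a fixed convex set. -/

section Projection

variable {n : ℕ} {K : Set (Euc n)}

theorem inner_sub_metricProj_le_zero (hK : IsClosed K) (hc : Convex ℝ K) (hne : K.Nonempty)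
    (y : Euc n) {w : Euc n} (hw : w ∈ K) :
    inner ℝ (y - metricProj K y) (w - metricProj K y) ≤ 0 := by
  obtain ⟨hp, hmin⟩ := metricProj_spec hK hne y
  have : Nonempty K := hne.to_subtype
  refine (norm_eq_iInf_iff_real_inner_le_zero hc hp).1 (le_antisymm ?_ ?_) w hw
  · exact le_ciInf fun w => by simpa [dist_eq_norm] using hmin w w.2
  · exact ciInf_le (f := fun w : K => ‖y - w‖)
      ⟨0, by rintro _ ⟨w, rfl⟩; exact norm_nonneg _⟩ ⟨_, hp⟩

theorem dist_metricProj (hK : IsClosed K) (hne : K.Nonempty) (y : Euc n) :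
    dist y (metricProj K y) = Metric.infDist y K := by
  obtain ⟨hp, hmin⟩ := metricProj_spec hK hne y
  exact le_antisymm ((Metric.le_infDist hne).2 fun {q} hq => hmin q hq)
    (Metric.infDist_le_dist_of_mem hp)

/-- Adding the variational inequalities of the two projections leaves a square. Monotonicity lets
the penalty term drop out of the stability estimate for the regularized flow. -/
theorem inner_sub_sub_metricProj_nonneg (hK : IsClosed K) (hc : Convex ℝ K) (hne : K.Nonempty)
    (y₁ y₂ : Euc n) :
    0 ≤ inner ℝ (y₁ - y₂) ((y₁ - metricProj K y₁) - (y₂ - metricProj K y₂)) := by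
  have h1 := inner_sub_metricProj_le_zero hK hc hne y₁ (metricProj_spec hK hne y₂).1
  have h2 := inner_sub_metricProj_le_zero hK hc hne y₂ (metricProj_spec hK hne y₁).1
  set p₁ := metricProj K y₁
  set p₂ := metricProj K y₂
  have h3 : inner ℝ (y₁ - y₂) ((y₁ - p₁) - (y₂ - p₂)) =
      ‖(y₁ - p₁) - (y₂ - p₂)‖ ^ 2 - inner ℝ (y₁ - p₁) (p₂ - p₁)
        - inner ℝ (y₂ - p₂) (p₁ - p₂) := by
    have e : y₁ - y₂ = ((y₁ - p₁) - (y₂ - p₂)) + (p₁ - p₂) := by abel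
    rw [e, inner_add_left, real_inner_self_eq_norm_sq, real_inner_comm, ← neg_sub p₁ p₂,
      inner_neg_right, inner_sub_left (y₁ - p₁)]
    ring
  rw [h3]
  nlinarith [sq_nonneg ‖(y₁ - p₁) - (y₂ - p₂)‖]

theorem inner_normalCone_monotone {x₁ x₂ v₁ v₂ : Euc n} (h₁ : v₁ ∈ normalCone K x₁)
    (h₂ : v₂ ∈ normalCone K x₂) : 0 ≤ inner ℝ (x₁ - x₂) (v₁ - v₂) := by
  have e1 := h₁.2 _ h₂.1
  have e2 := h₂.2 _ h₁.1
  rw [← neg_sub x₁ x₂, inner_neg_right] at e1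
  rw [inner_sub_right, real_inner_comm, real_inner_comm v₂]
  linarith

/-- Testing the normal cone at x with p = proj y, and the projection of y with x, leaves |v||y - p|
- |y - p|²/λ, which Young's inequality bounds by λ|v|²/4. -/
theorem inner_penalty_normalCone_le (hK : IsClosed K) (hc : Convex ℝ K) {x v : Euc n}
    (hv : v ∈ normalCone K x) {lam : ℝ} (hlam : 0 < lam) (y : Euc n) :
    inner ℝ (y - x) (v - (1 / lam) • (y - metricProj K y)) ≤ lam / 4 * ‖v‖ ^ 2 := by
  have hne : K.Nonempty := ⟨x, hv.1⟩
  have h1 := inner_sub_metricProj_le_zero hK hc hne y hv.1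
  have h2 := hv.2 _ (metricProj_spec hK hne y).1
  set p := metricProj K y
  have e1 : inner ℝ (y - x) v = inner ℝ v (p - x) + inner ℝ v (y - p) := by
    rw [real_inner_comm, ← inner_add_right]; congr 1; abel
  have e2 : inner ℝ (y - x) (y - p) = ‖y - p‖ ^ 2 - inner ℝ (y - p) (x - p) := by
    rw [← real_inner_self_eq_norm_sq, ← inner_sub_right, real_inner_comm]; congr 1; abel
  have h3 := real_inner_le_norm v (y - p)
  rw [inner_sub_right, real_inner_smul_right, e1, e2]
  have h4 : 1 / lam * ‖y - p‖ ^ 2 ≤ 1 / lam * (‖y - p‖ ^ 2 - inner ℝ (y - p) (x - p)) :=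
    mul_le_mul_of_nonneg_left (by linarith) (by positivity)
  have h5 : ‖v‖ * ‖y - p‖ ≤ lam / 4 * ‖v‖ ^ 2 + 1 / lam * ‖y - p‖ ^ 2 := by
    have : lam / 4 * ‖v‖ ^ 2 + 1 / lam * ‖y - p‖ ^ 2 - ‖v‖ * ‖y - p‖
        = 1 / lam * (lam / 2 * ‖v‖ - ‖y - p‖) ^ 2 := by field_simp; ring
    have : 0 ≤ 1 / lam * (lam / 2 * ‖v‖ - ‖y - p‖) ^ 2 := by positivity
    linarith
  linarith

end Projection

/-! ### Consequences of the Lipschitz motion of the sets. -/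

/-- The standing assumptions on the data `f`, `S` of the sweeping process. -/
structure SweepingData {n : ℕ} (f : ℝ → Euc n → Euc n) (S : ℝ → Set (Euc n))
    (T Lf Ls : ℝ) : Prop where
  Lf_pos : 0 < Lf
  Ls_nonneg : 0 ≤ Ls
  growth : ∀ t ∈ Icc 0 T, ∀ x, ‖f t x‖ ≤ Lf * (1 + ‖x‖)
  lip : ∀ t ∈ Icc 0 T, ∀ x₁ x₂, ‖f t x₁ - f t x₂‖ ≤ Lf * ‖x₁ - x₂‖
  closed : ∀ t ∈ Icc 0 T, IsClosed (S t)
  convex : ∀ t ∈ Icc 0 T, Convex ℝ (S t)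
  hausdorff : ∀ t ∈ Icc 0 T, ∀ s ∈ Icc 0 T,
    Metric.hausdorffEDist (S t) (S s) ≤ ENNReal.ofReal (Ls * |t - s|)

namespace SweepingData

variable {n : ℕ} {f : ℝ → Euc n → Euc n} {S : ℝ → Set (Euc n)} {T Lf Ls : ℝ}

theorem infDist_le (D : SweepingData f S T Lf Ls) {s t : ℝ} (hs : s ∈ Icc 0 T)
    (ht : t ∈ Icc 0 T) (y : Euc n) :
    Metric.infDist y (S t) ≤ Metric.infDist y (S s) + Ls * |s - t| := by
  have h := D.hausdorff s hs t ht
  have hfin : Metric.hausdorffEDist (S s) (S t) ≠ ⊤ := (h.trans_lt ENNReal.ofReal_lt_top).ne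
  have h2 : Metric.hausdorffDist (S s) (S t) ≤ Ls * |s - t| :=
    ENNReal.toReal_le_of_le_ofReal (mul_nonneg D.Ls_nonneg (abs_nonneg _)) h
  have := Metric.infDist_le_infDist_add_hausdorffDist (x := y) hfin
  linarith

theorem nonempty (D : SweepingData f S T Lf Ls) {s t : ℝ} (hs : s ∈ Icc 0 T)
    (ht : t ∈ Icc 0 T) (hne : (S s).Nonempty) : (S t).Nonempty :=
  Metric.nonempty_of_hausdorffEDist_ne_top hne
    ((D.hausdorff s hs t ht).trans_lt ENNReal.ofReal_lt_top).ne

theorem continuousOn_infDist (D : SweepingData f S T Lf Ls) {x : ℝ → Euc n}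
    (hx : ContinuousOn x (Icc 0 T)) :
    ContinuousOn (fun s => Metric.infDist (x s) (S s)) (Icc 0 T) := by
  intro t ht
  have hb : ∀ s ∈ Icc 0 T, dist (Metric.infDist (x s) (S s)) (Metric.infDist (x t) (S t)) ≤
      dist (x s) (x t) + Ls * |s - t| := by
    intro s hs
    have h1 := D.infDist_le hs ht (x t)
    have h2 := D.infDist_le ht hs (x s)
    have h3 := Metric.infDist_le_infDist_add_dist (s := S s) (x := x t) (y := x s)
    have h4 := Metric.infDist_le_infDist_add_dist (s := S t) (x := x s) (y := x t)
    rw [dist_comm] at h3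
    rw [abs_sub_comm] at h2
    rw [Real.dist_eq, abs_le]
    constructor <;> linarith
  refine tendsto_iff_dist_tendsto_zero.2 (squeeze_zero' (Eventually.of_forall fun _ => dist_nonneg)
    (eventually_mem_nhdsWithin.mono hb) ?_)
  have hc : ContinuousWithinAt (fun s => dist (x s) (x t) + Ls * |s - t|) (Icc 0 T) t :=
    ((hx t ht).dist continuousWithinAt_const).add
      (Continuous.continuousWithinAt (by fun_prop))
  simpa [ContinuousWithinAt] using hc

end SweepingData

/-! ### A priori estimates for the sweeping process. -/

namespace IsSweepingSolution

variable {n : ℕ} {f : ℝ → Euc n → Euc n} {S : ℝ → Set (Euc n)} {T Lf Ls : ℝ} {x₀ : Euc n}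
  {x : ℝ → Euc n}

/-- The inclusion forces x(t) ∈ S(t) only almost everywhere; continuity of the distance to S(t)
extends this to every t. -/
theorem mem (D : SweepingData f S T Lf Ls) (h : IsSweepingSolution f S T x₀ x) (hx₀ : x₀ ∈ S 0)
    {t : ℝ} (ht : t ∈ Icc 0 T) : x t ∈ S t := by
  have hT : 0 ≤ T := ht.1.trans ht.2
  rcases hT.eq_or_lt with rfl | hT'
  -- For T = 0 the almost-everywhere condition is void, and only x₀ ∈ S(0) helps.
  · obtain rfl : t = 0 := le_antisymm ht.2 ht.1
    rwa [h.2.1]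
  have hc := D.continuousOn_infDist (by simpa [uIcc_of_le hT] using h.1.continuousOn)
  have he := Measure.eqOn_Icc_of_ae_eq volume hT'.ne (g := fun _ => (0 : ℝ)) (by
    filter_upwards [h.2.2] with s ⟨v, hv, _⟩
    exact Metric.infDist_zero_of_mem hv.1) hc continuousOn_const
  exact ((D.closed t ht).mem_iff_infDist_zero
    (D.nonempty (left_mem_Icc.2 hT) ht ⟨x₀, hx₀⟩)).2 (he ht)

/-- For s < t the point x(s) ∈ S(s) lies within L_s(t - s) of S(t), so ⟨v, x(s) - x(t)⟩ ≤ L_s|v|(t -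
s). Dividing by s - t < 0 reverses the inequality, which is why left difference quotients are used.
-/
theorem neg_le_inner_deriv (D : SweepingData f S T Lf Ls) (h : IsSweepingSolution f S T x₀ x)
    (hx₀ : x₀ ∈ S 0) {t : ℝ} (ht : t ∈ Ioc 0 T) {v x' : Euc n} (hv : v ∈ normalCone (S t) (x t))
    (hx' : HasDerivAt x x' t) : -(Ls * ‖v‖) ≤ inner ℝ v x' := by
  have ht' : t ∈ Icc 0 T := Ioc_subset_Icc_self ht
  have hlim : Tendsto (fun s => inner ℝ v (slope x t s)) (𝓝[<] t) (𝓝 (inner ℝ v x')) :=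
    tendsto_const_nhds.inner ((hasDerivAt_iff_tendsto_slope.1 hx').mono_left
      (nhdsWithin_mono _ fun s hs => ne_of_lt hs))
  refine ge_of_tendsto hlim ?_
  filter_upwards [Ioo_mem_nhdsLT ht.1] with s hs
  have hs' : s ∈ Icc 0 T := ⟨hs.1.le, hs.2.le.trans ht.2⟩
  have hne : (S t).Nonempty := ⟨_, hv.1⟩
  have hst : 0 < t - s := sub_pos.2 hs.2
  set y := metricProj (S t) (x s)
  have h1 : ‖x s - y‖ ≤ Ls * (t - s) := by
    rw [← dist_eq_norm, dist_metricProj (D.closed t ht') hne]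
    have := D.infDist_le hs' ht' (x s)
    rwa [Metric.infDist_zero_of_mem (h.mem D hx₀ hs'), zero_add, abs_sub_comm,
      abs_of_pos hst] at this
  have h2 : inner ℝ v (y - x t) ≤ 0 := hv.2 _ (metricProj_spec (D.closed t ht') hne _).1
  have h3 := (real_inner_le_norm v (x s - y)).trans
    (mul_le_mul_of_nonneg_left h1 (norm_nonneg v))
  have h4 : inner ℝ v (x s - x t) = inner ℝ v (x s - y) + inner ℝ v (y - x t) := by
    rw [← inner_add_right]; congr 1; abel
  have h5 : inner ℝ v (slope x t s) = -(inner ℝ v (x s - x t) / (t - s)) := by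
    rw [slope, vsub_eq_sub, real_inner_smul_right, ← neg_sub t s, inv_neg]; ring
  rw [h5, neg_le_neg_iff, div_le_iff₀ hst]
  linarith

/-- The pointwise estimates satisfied almost everywhere by a solution of the sweeping process. -/
theorem ae_estimates (D : SweepingData f S T Lf Ls) (h : IsSweepingSolution f S T x₀ x)
    (hx₀ : x₀ ∈ S 0) : ∀ᵐ t ∂volume.restrict (Icc 0 T), ∃ v ∈ normalCone (S t) (x t), ∃ r' : ℝ,
      HasDerivAt x (f t (x t) - v) t ∧ HasDerivAt (fun s => ‖x s‖) r' t ∧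
      ‖v‖ ≤ Lf * (1 + ‖x t‖) + Ls ∧ r' ≤ Lf * (1 + ‖x t‖) + Ls ∧
      ‖v‖ ^ 2 ≤ (Lf * (1 + ‖x t‖)) ^ 2 - r' ^ 2 + 2 * Ls * ‖v‖ := by
  rcases lt_or_ge T 0 with hT | hT
  · simp [Icc_eq_empty_of_lt hT]
  -- |x| is itself absolutely continuous, so r' exists almost everywhere and zeros of x need no
  -- separate treatment.
  have hd := h.1.norm_comp.ae_differentiableAt
  rw [uIcc_of_le hT] at hd
  have h0 : ∀ᵐ t ∂volume.restrict (Icc 0 T), t ≠ 0 :=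
    ae_restrict_of_ae (by simp [ae_iff, measure_singleton])
  filter_upwards [h.2.2, ae_restrict_of_ae hd, h0, ae_restrict_mem measurableSet_Icc]
    with t ⟨v, hv, hx'⟩ hdt ht0 ht
  have hr := (hdt ht).hasDerivAt
  refine ⟨v, hv, _, hx', hr, ?_⟩
  have hab := hx'.abs_le_of_norm hr
  set r' := deriv (fun s => ‖x s‖) t
  have hg := D.growth t ht (x t)
  have hin := h.neg_le_inner_deriv D hx₀ ⟨lt_of_le_of_ne ht.1 ht0.symm, ht.2⟩ hv hx'
  set F := Lf * (1 + ‖x t‖)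
  have hs := D.Ls_nonneg
  have hF : 0 ≤ F := (norm_nonneg _).trans hg
  have hvn := norm_nonneg v
  have hcs := real_inner_le_norm v (f t (x t))
  have e1 : inner ℝ v (f t (x t) - v) = inner ℝ v (f t (x t)) - ‖v‖ ^ 2 := by
    rw [inner_sub_right, real_inner_self_eq_norm_sq]
  have e2 : ‖f t (x t) - v‖ ^ 2 = ‖f t (x t)‖ ^ 2 - 2 * inner ℝ v (f t (x t)) + ‖v‖ ^ 2 := by
    rw [norm_sub_sq_real, real_inner_comm]
  have hsq : r' ^ 2 ≤ ‖f t (x t) - v‖ ^ 2 := by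
    rw [← sq_abs r']; exact pow_le_pow_left₀ (abs_nonneg _) hab 2
  have hF2 : ‖f t (x t)‖ ^ 2 ≤ F ^ 2 := pow_le_pow_left₀ (norm_nonneg _) hg 2
  -- Expand r'² ≤ |f - v|² and use |v|² ≤ ⟨v, f⟩ + L_s|v|.
  have key : ‖v‖ ^ 2 ≤ F ^ 2 - r' ^ 2 + 2 * Ls * ‖v‖ := by linarith
  have hvF : ‖v‖ * ‖f t (x t)‖ ≤ ‖v‖ * F := mul_le_mul_of_nonneg_left hg hvn
  refine ⟨?_, ?_, key⟩
  · by_contra! hlt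
    have : 0 < ‖v‖ * (‖v‖ - (F + Ls)) := mul_pos (by linarith) (by linarith)
    linarith
  · refine le_of_sq_le_sq ?_ (by linarith)
    -- Since 2L_s|v| - |v|² ≤ L_s², `key` gives r'² ≤ F² + L_s² ≤ (F + L_s)².
    nlinarith [sq_nonneg (‖v‖ - Ls), mul_nonneg hF hs]

end IsSweepingSolution

/-! ### Lipschitz dependence of both flows on the initial point. -/

theorem AbsolutelyContinuousOnInterval.mono_right {E : Type*} [PseudoMetricSpace E] {x : ℝ → E}
    {t T : ℝ} (hx : AbsolutelyContinuousOnInterval x 0 T) (ht : t ∈ Icc 0 T) :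
    AbsolutelyContinuousOnInterval x 0 t :=
  hx.mono (by rw [uIcc_of_le ht.1, uIcc_of_le (ht.1.trans ht.2)]; exact Icc_subset_Icc_right ht.2)

theorem hasDerivAt_exp_neg_mul (L s : ℝ) :
    HasDerivAt (fun s => Real.exp (-L * s)) (-(L * Real.exp (-L * s))) s := by
  refine ((hasDerivAt_id s).const_mul (-L)).exp.congr_deriv ?_
  simp only [id]; ring

theorem norm_sub_le_exp_of_inner_le {n : ℕ} {x y : ℝ → Euc n} {T L t : ℝ} (ht : t ∈ Icc 0 T)
    (hx : AbsolutelyContinuousOnInterval x 0 T) (hy : AbsolutelyContinuousOnInterval y 0 T)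
    (h : ∀ᵐ s ∂volume.restrict (Icc 0 T), ∃ x' y', HasDerivAt x x' s ∧ HasDerivAt y y' s ∧
      inner ℝ (x s - y s) (x' - y') ≤ L * ‖x s - y s‖ ^ 2) :
    ‖x t - y t‖ ≤ Real.exp (L * t) * ‖x 0 - y 0‖ := by
  have := exp_mul_norm_sq_sub_le (z := fun s => x s - y s) (G := fun _ => 0) (L := L) ht.1
    ((hx.fun_sub hy).mono_right ht) (AbsolutelyContinuousOnInterval.of_contDiff contDiff_const 0 t)
    (by
      filter_upwards [ae_restrict_of_ae_restrict_of_subset (Icc_subset_Icc_right ht.2) h]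
        with s ⟨x', y', hx', hy', hle⟩
      exact ⟨_, 0, hx'.sub hy', hasDerivAt_const s 0, by linarith⟩)
  have hp := Real.exp_pos (L * t)
  rw [sub_zero, sub_nonpos, inv_mul_le_iff₀ (by positivity), ← mul_pow] at this
  exact le_of_sq_le_sq this (by positivity)

section Flows

variable {n : ℕ} {f : ℝ → Euc n → Euc n} {S : ℝ → Set (Euc n)} {T Lf Ls lam t : ℝ}

theorem SweepingData.inner_sub_le (D : SweepingData f S T Lf Ls) (ht : t ∈ Icc 0 T)
    (x y : Euc n) : inner ℝ (x - y) (f t x - f t y) ≤ Lf * ‖x - y‖ ^ 2 := by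
  have h := (real_inner_le_norm (x - y) (f t x - f t y)).trans
    (mul_le_mul_of_nonneg_left (D.lip t ht x y) (norm_nonneg _))
  linarith

theorem IsSweepingSolution.norm_sub_le (D : SweepingData f S T Lf Ls) {x₀ y₀ : Euc n}
    {x y : ℝ → Euc n} (hx : IsSweepingSolution f S T x₀ x) (hy : IsSweepingSolution f S T y₀ y)
    (ht : t ∈ Icc 0 T) : ‖x t - y t‖ ≤ Real.exp (Lf * t) * ‖x₀ - y₀‖ := by
  have := norm_sub_le_exp_of_inner_le (L := Lf) ht hx.1 hy.1 (by
    filter_upwards [hx.2.2, hy.2.2, ae_restrict_mem measurableSet_Icc]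
      with s ⟨v, hv, hx'⟩ ⟨w, hw, hy'⟩ hs
    refine ⟨_, _, hx', hy', ?_⟩
    have h1 := D.inner_sub_le hs (x s) (y s)
    have h2 := inner_normalCone_monotone hv hw
    rw [sub_sub_sub_comm, inner_sub_right]
    linarith)
  rwa [hx.2.1, hy.2.1] at this

theorem IsRegularizedSolution.norm_sub_le (D : SweepingData f S T Lf Ls) (hlam : 0 < lam)
    (hne : (S 0).Nonempty) {x₀ y₀ : Euc n} {x y : ℝ → Euc n}
    (hx : IsRegularizedSolution f S T lam x₀ x) (hy : IsRegularizedSolution f S T lam y₀ y)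
    (ht : t ∈ Icc 0 T) : ‖x t - y t‖ ≤ Real.exp (Lf * t) * ‖x₀ - y₀‖ := by
  have := norm_sub_le_exp_of_inner_le (L := Lf) ht hx.1 hy.1 (by
    filter_upwards [hx.2.2, hy.2.2, ae_restrict_mem measurableSet_Icc] with s hx' hy' hs
    refine ⟨_, _, hx', hy', ?_⟩
    have h1 := D.inner_sub_le hs (x s) (y s)
    have h2 := inner_sub_sub_metricProj_nonneg (D.closed s hs) (D.convex s hs)
      (D.nonempty (left_mem_Icc.2 (ht.1.trans ht.2)) hs hne) (x s) (y s)
    rw [sub_sub_sub_comm, inner_sub_right, ← smul_sub, real_inner_smul_right]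
    have := mul_nonneg (one_div_pos.2 hlam).le h2
    linarith)
  rwa [hx.2.1, hy.2.1] at this

/-! ### Measurability and couplings. -/

theorem continuousOn_of_norm_sub_le {E F : Type*} [SeminormedAddCommGroup E]
    [SeminormedAddCommGroup F] {K : Set E} {g : E → F} {C : ℝ} (hC : 0 ≤ C)
    (h : ∀ x ∈ K, ∀ y ∈ K, ‖g x - g y‖ ≤ C * ‖x - y‖) : ContinuousOn g K :=
  (LipschitzOnWith.of_dist_le_mul (K := C.toNNReal) fun x hx y hy => by
    simpa only [dist_eq_norm, Real.coe_toNNReal C hC] using h x hx y hy).continuousOn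

theorem aemeasurable_of_continuousOn_closed {K : Set (Euc n)} (hK : IsClosed K)
    {g : Euc n → Euc n} (hg : ContinuousOn g K) {μ : Measure (Euc n)} (hμ : μ Kᶜ = 0) :
    AEMeasurable g μ := by
  have := hg.aemeasurable (μ := μ) hK.measurableSet
  rwa [Measure.restrict_eq_self_of_ae_mem (by exact hμ)] at this

theorem wasserstein1_map_le {μ : Measure (Euc n)} {F G : Euc n → Euc n} (hF : AEMeasurable F μ)
    (hG : AEMeasurable G μ) :
    wasserstein1 (μ.map F) (μ.map G) ≤ ∫⁻ x, ‖F x - G x‖ₑ ∂μ := by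
  have hFG := hF.prodMk hG
  refine (iInf₂_le (μ.map fun x => (F x, G x)) ⟨?_, ?_⟩).trans_eq ?_
  · rw [lintegral_map' (by fun_prop) hFG]
  · rw [AEMeasurable.map_map_of_aemeasurable measurable_fst.aemeasurable hFG]; rfl
  · rw [AEMeasurable.map_map_of_aemeasurable measurable_snd.aemeasurable hFG]; rfl

theorem wasserstein1_map_le_of_norm_sub_le {μ : Measure (Euc n)} [IsProbabilityMeasure μ]
    {K : Set (Euc n)} (hμ : μ Kᶜ = 0) {F G : Euc n → Euc n} (hF : AEMeasurable F μ)
    (hG : AEMeasurable G μ) {a b c : ℝ} (ha : 0 ≤ a) (hb : 0 ≤ b)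
    (h : ∀ x ∈ K, ‖G x - F x‖ ≤ (a + b * ‖x‖) * c) :
    wasserstein1 (μ.map F) (μ.map G) ≤
      (ENNReal.ofReal a + ENNReal.ofReal b * ∫⁻ x, ‖x‖ₑ ∂μ) * ENNReal.ofReal c := by
  refine (wasserstein1_map_le hF hG).trans ?_
  have hle : ∀ᵐ x ∂μ, ‖F x - G x‖ₑ ≤
      (ENNReal.ofReal a + ENNReal.ofReal b * ‖x‖ₑ) * ENNReal.ofReal c := by
    filter_upwards [show ∀ᵐ x ∂μ, x ∈ K from hμ] with x hx
    rw [← ofReal_norm, ← ofReal_norm, ← ENNReal.ofReal_mul hb,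
      ← ENNReal.ofReal_add ha (by positivity), ← ENNReal.ofReal_mul (by positivity), norm_sub_rev]
    exact ENNReal.ofReal_le_ofReal (h x hx)
  refine (lintegral_mono_ae hle).trans_eq ?_
  rw [lintegral_mul_const _ (by fun_prop), lintegral_add_left (by fun_prop),
    lintegral_const_mul _ (by fun_prop)]
  simp

/-! ### Energy comparison and growth. -/

/-- Energy comparison of a solution of the regularized equation with a solution of the sweeping
process. -/
theorem norm_sq_sub_le_of_energy (D : SweepingData f S T Lf Ls) (hlam : 0 < lam) {x₀ : Euc n}
    (hx₀ : x₀ ∈ S 0) {x y : ℝ → Euc n} (hx : IsSweepingSolution f S T x₀ x)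
    (hy : IsRegularizedSolution f S T lam x₀ y) (ht : t ∈ Icc 0 T) {G : ℝ → ℝ}
    (hG : AbsolutelyContinuousOnInterval G 0 T)
    (h : ∀ s ∈ Icc 0 T, ∀ b r' : ℝ, 0 ≤ b → HasDerivAt (fun s => ‖x s‖) r' s →
      b ≤ Lf * (1 + ‖x s‖) + Ls → b ^ 2 ≤ (Lf * (1 + ‖x s‖)) ^ 2 - r' ^ 2 + 2 * Ls * b →
      ∃ g', HasDerivAt G g' s ∧ b ^ 2 ≤ Real.exp (Lf * s) ^ 2 * g') :
    ‖y t - x t‖ ^ 2 ≤ lam / 2 * Real.exp (Lf * t) ^ 2 * (G t - G 0) := by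
  have := exp_mul_norm_sq_sub_le (z := fun s => y s - x s) (G := fun s => lam / 2 * G s)
    (L := Lf) ht.1 ((hy.1.fun_sub hx.1).mono_right ht) ((hG.const_mul _).mono_right ht) (by
      refine ae_restrict_of_ae_restrict_of_subset (Icc_subset_Icc_right ht.2) ?_
      filter_upwards [hx.ae_estimates D hx₀, hy.2.2, ae_restrict_mem measurableSet_Icc]
        with s ⟨v, hv, r', hx', hr', hvb, _, hv2⟩ hy' hs
      obtain ⟨g', hg', hle⟩ := h s hs ‖v‖ r' (norm_nonneg v) hr' hvb hv2
      refine ⟨_, _, hy'.sub hx', hg'.const_mul _, ?_⟩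
      have h1 := D.inner_sub_le hs (y s) (x s)
      have h2 := inner_penalty_normalCone_le (D.closed s hs) (D.convex s hs) hv hlam (y s)
      have h3 := mul_le_mul_of_nonneg_left hle (half_pos hlam).le
      -- The field difference is absorbed by the Gronwall term; the penalty difference costs
      -- λ|v|²/4, doubled to λ/2 in the derivative of |z|².
      rw [show ∀ a b c d : Euc n, a - b - (c - d) = (a - c) + (d - b) by intros; abel,
        inner_add_right]
      linarith)
  have hp := Real.exp_pos (Lf * t)
  simp only [hx.2.1, hy.2.1, sub_self, norm_zero] at this
  rw [zero_pow two_ne_zero, sub_zero, inv_mul_le_iff₀ (by positivity)] at this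
  linarith

/-- Since r' ≤ L_f(1+|x|) + L_s, the left side has derivative L_f r' at most L_f times itself. -/
theorem IsSweepingSolution.growth_le (D : SweepingData f S T Lf Ls) {x₀ : Euc n}
    (hx₀ : x₀ ∈ S 0) {x : ℝ → Euc n} (hx : IsSweepingSolution f S T x₀ x) (ht : t ∈ Icc 0 T) :
    Lf * (1 + ‖x t‖) + Ls ≤ Real.exp (Lf * t) * (Lf * (1 + ‖x₀‖) + Ls) := by
  have hc : ∀ c : ℝ, AbsolutelyContinuousOnInterval (fun _ => c) 0 T := fun c =>
    AbsolutelyContinuousOnInterval.of_contDiff contDiff_const 0 T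
  have hac : AbsolutelyContinuousOnInterval
      (fun s => Real.exp (-Lf * s) * (Lf * (1 + ‖x s‖) + Ls)) 0 T :=
    (AbsolutelyContinuousOnInterval.of_contDiff (by fun_prop) 0 T).fun_mul
      ((((hc 1).fun_add hx.1.norm_comp).const_mul Lf).fun_add (hc Ls))
  have := (hac.mono_right ht).le_of_ae_hasDerivAt_nonpos ht.1 (by
    refine ae_restrict_of_ae_restrict_of_subset (Icc_subset_Icc_right ht.2) ?_
    filter_upwards [hx.ae_estimates D hx₀] with s ⟨v, _, r', _, hr', _, hrb, _⟩
    refine ⟨_, ?_, (hasDerivAt_exp_neg_mul Lf s).mul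
      (((hr'.const_add 1).const_mul Lf).add_const Ls)⟩
    have : 0 ≤ Real.exp (-Lf * s) * Lf * (Lf * (1 + ‖x s‖) + Ls - r') :=
      mul_nonneg (mul_pos (Real.exp_pos _) D.Lf_pos).le (sub_nonneg.2 hrb)
    linarith)
  rw [hx.2.1, mul_zero, Real.exp_zero, one_mul, neg_mul, Real.exp_neg,
    inv_mul_le_iff₀ (Real.exp_pos _)] at this
  exact this

end Flows

/-! ### The two convergence rates. -/

section Rates

variable {n : ℕ} {f : ℝ → Euc n → Euc n} {S : ℝ → Set (Euc n)} {T Lf Ls lam t : ℝ}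

theorem norm_sq_sub_le_linear (D : SweepingData f S T Lf Ls) (hlam : 0 < lam) {x₀ : Euc n}
    (hx₀ : x₀ ∈ S 0) {x y : ℝ → Euc n} (hx : IsSweepingSolution f S T x₀ x)
    (hy : IsRegularizedSolution f S T lam x₀ y) (ht : t ∈ Icc 0 T) :
    ‖y t - x t‖ ^ 2 ≤
      lam / 2 * Real.exp (Lf * t) ^ 2 * ((Lf * (1 + ‖x₀‖) + Ls) ^ 2 * t) := by
  have := norm_sq_sub_le_of_energy D hlam hx₀ hx hy ht
    (G := fun s => (Lf * (1 + ‖x₀‖) + Ls) ^ 2 * s)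
    (AbsolutelyContinuousOnInterval.of_contDiff (by fun_prop) 0 T) (by
      intro s hs b r' hb _ hbs _
      refine ⟨_, (hasDerivAt_id s).const_mul _, ?_⟩
      rw [mul_one, ← mul_pow]
      exact pow_le_pow_left₀ hb (hbs.trans (hx.growth_le D hx₀ hs)) 2)
  simpa using this

/-- With w = e^{-L_f s}(1+r), e^{-2L_f s}(L_f²(1+r)² - r'²) = -w'² - L_f(w²)', and -w'² ≤ L_f²c² +
2L_f c w' for every constant c. The resulting majorant is an exact derivative. The term 2L_s|v| is
bounded through `growth_le`. -/
theorem norm_sq_sub_le_quadratic (D : SweepingData f S T Lf Ls) (hlam : 0 < lam) {x₀ : Euc n}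
    (hx₀ : x₀ ∈ S 0) {x y : ℝ → Euc n} (hx : IsSweepingSolution f S T x₀ x)
    (hy : IsRegularizedSolution f S T lam x₀ y) (ht : t ∈ Icc 0 T) :
    ‖y t - x t‖ ^ 2 ≤ lam / 2 * Real.exp (Lf * t) ^ 2 *
      (Lf * (1 + ‖x₀‖) ^ 2 * (1 - (Real.exp (Lf * t) ^ 2)⁻¹) +
        2 * Ls * (Lf * (1 + ‖x₀‖) + Ls) / Lf * (1 - (Real.exp (Lf * t))⁻¹)) := by
  have hL := D.Lf_pos
  have hs0 := D.Ls_nonneg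
  set R₀ := 1 + ‖x₀‖ with hR₀
  set A := Lf * R₀ + Ls
  -- This c minimizes L_f c²(1 + L_f t) - 2L_f c R₀, which remains once -L_f(w(t) - c)² is
  -- discarded.
  set c := R₀ / (1 + Lf * t) with hc
  set w : ℝ → ℝ := fun s => Real.exp (-Lf * s) * (1 + ‖x s‖) with hw
  have hcon : ∀ c : ℝ, AbsolutelyContinuousOnInterval (fun _ => c) 0 T := fun c =>
    AbsolutelyContinuousOnInterval.of_contDiff contDiff_const 0 T
  have hwac : AbsolutelyContinuousOnInterval w 0 T :=
    (AbsolutelyContinuousOnInterval.of_contDiff (by fun_prop) 0 T).fun_mul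
      ((hcon 1).fun_add hx.1.norm_comp)
  have := norm_sq_sub_le_of_energy D hlam hx₀ hx hy ht
    (G := fun s => (Lf ^ 2 * c ^ 2 * s - 2 * Ls * A / Lf * Real.exp (-Lf * s)) +
      (2 * Lf * c * w s - Lf * (w s * w s)))
    ((AbsolutelyContinuousOnInterval.of_contDiff (by fun_prop) 0 T).fun_add
      ((hwac.const_mul _).fun_sub ((hwac.fun_mul hwac).const_mul _))) (by
      intro s hs b r' hb hr' hbs hb2
      have hw' : HasDerivAt w _ s := (hasDerivAt_exp_neg_mul Lf s).mul (hr'.const_add 1)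
      refine ⟨_, (((hasDerivAt_id s).const_mul (Lf ^ 2 * c ^ 2)).sub
        ((hasDerivAt_exp_neg_mul Lf s).const_mul (2 * Ls * A / Lf))).add
        ((hw'.const_mul _).sub ((hw'.mul hw').const_mul _)), ?_⟩
      have hg := hbs.trans (hx.growth_le D hx₀ hs)
      have hp := Real.exp_pos (Lf * s)
      simp only [hw, neg_mul, Real.exp_neg]
      set R := 1 + ‖x s‖
      set e := (Real.exp (Lf * s))⁻¹ with he
      have hep : 0 < e := inv_pos.2 hp
      have hee : Real.exp (Lf * s) = e⁻¹ := by rw [he, inv_inv]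
      rw [hee] at hg ⊢
      rw [inv_pow, ← div_eq_inv_mul, le_div_iff₀ (by positivity)]
      have h1 : e * b ≤ A := by rwa [← div_eq_inv_mul, le_div_iff₀ hep, mul_comm] at hg
      have h2 : 2 * Ls * e * (e * b) ≤ 2 * Ls * e * A :=
        mul_le_mul_of_nonneg_left h1 (by positivity)
      have h3 := mul_le_mul_of_nonneg_left hb2 (sq_nonneg e)
      have h4 := sq_nonneg (e * (r' - Lf * R) + Lf * c)
      have h5 : 2 * Ls * A / Lf * (Lf * e) = 2 * Ls * e * A := by field_simp
      linarith)
  refine this.trans (mul_le_mul_of_nonneg_left ?_ (by positivity))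
  have hq : 1 ≤ Real.exp (Lf * t) := Real.one_le_exp (mul_nonneg hL.le ht.1)
  have hLt : 0 ≤ Lf * t := mul_nonneg hL.le ht.1
  have hw0 : w 0 = R₀ := by simp [hw, hx.2.1, hR₀]
  -- Turns the optimal value L_f R₀²(1 - 1/(1 + L_f t)) into the exponential form.
  have hq2 : 1 + Lf * t ≤ Real.exp (Lf * t) ^ 2 := by
    have := Real.add_one_le_exp (Lf * t)
    nlinarith
  have hcR : Lf * R₀ ^ 2 * (Real.exp (Lf * t) ^ 2)⁻¹ ≤ Lf * R₀ * c := by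
    have : (Real.exp (Lf * t) ^ 2)⁻¹ ≤ (1 + Lf * t)⁻¹ := inv_anti₀ (by linarith) hq2
    have := mul_le_mul_of_nonneg_left this (show 0 ≤ Lf * R₀ ^ 2 by positivity)
    rw [hc, div_eq_mul_inv]; linarith
  have hc1 : c * (1 + Lf * t) = R₀ := div_mul_cancel₀ _ (by positivity)
  have hcc : Lf * c * (c * (1 + Lf * t)) = Lf * c * R₀ := by rw [hc1]
  have h4 : 0 ≤ Lf * (w t - c) ^ 2 := by positivity
  simp only [hw0, neg_mul, Real.exp_neg, mul_zero, Real.exp_zero]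
  linarith

theorem norm_sub_le_sqrt_of_sq_le {E : Type*} [SeminormedAddCommGroup E] {z : E} {M c : ℝ}
    (hM : 0 ≤ M) (h : ‖z‖ ^ 2 ≤ M ^ 2 * c) : ‖z‖ ≤ M * √c := by
  have := Real.le_sqrt_of_sq_le h
  rwa [Real.sqrt_mul (sq_nonneg M), Real.sqrt_sq hM] at this

theorem sweepKappa_nonneg (hLf : 0 < Lf) (hLs : 0 ≤ Ls) (hT : 0 ≤ T) :
    0 ≤ sweepKappa Lf Ls T :=
  mul_nonneg (sub_nonneg.2 (Real.one_le_exp (by positivity))) (by positivity)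

theorem exp_two_mul_mul (a b : ℝ) : Real.exp (2 * a * b) = Real.exp (a * b) ^ 2 := by
  rw [← Real.exp_nat_mul]; congr 1; push_cast; ring

theorem mul_sweepKappa (hLf : 0 < Lf) :
    Lf * sweepKappa Lf Ls T = (Real.exp (Lf * T) ^ 2 - 1) * (Lf + Ls / 2) := by
  rw [sweepKappa, exp_two_mul_mul]; field_simp

theorem norm_sub_le_sqrt_exp_two_mul (D : SweepingData f S T Lf Ls) (hlam : 0 < lam) {x₀ : Euc n}
    (hx₀ : x₀ ∈ S 0) {x y : ℝ → Euc n} (hx : IsSweepingSolution f S T x₀ x)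
    (hy : IsRegularizedSolution f S T lam x₀ y) (ht : t ∈ Icc 0 T) :
    ‖y t - x t‖ ≤ (Lf * (1 + sweepKappa Lf Ls T + ‖x₀‖) + Ls) *
      √(lam * (Real.exp (2 * Lf * t) - 1) / (2 * Lf)) := by
  have hL := D.Lf_pos
  have hs := D.Ls_nonneg
  have hk := sweepKappa_nonneg hL hs (ht.1.trans ht.2)
  refine norm_sub_le_sqrt_of_sq_le (by positivity)
    ((norm_sq_sub_le_quadratic D hlam hx₀ hx hy ht).trans ?_)
  rw [exp_two_mul_mul]
  have hq : 1 ≤ Real.exp (Lf * t) := Real.one_le_exp (mul_nonneg hL.le ht.1)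
  have hqQ : Real.exp (Lf * t) ≤ Real.exp (Lf * T) :=
    Real.exp_le_exp.2 (mul_le_mul_of_nonneg_left ht.2 hL.le)
  have hkap := mul_sweepKappa (Ls := Ls) (T := T) hL
  set q := Real.exp (Lf * t)
  set Q := Real.exp (Lf * T)
  set k := Lf * sweepKappa Lf Ls T
  set A := Lf * (1 + ‖x₀‖) with hA
  have hA0 : 0 ≤ A := by positivity
  have hqp : 0 < q := by linarith
  have e1 : lam / 2 * q ^ 2 * (Lf * (1 + ‖x₀‖) ^ 2 * (1 - (q ^ 2)⁻¹) +
      2 * Ls * (A + Ls) / Lf * (1 - q⁻¹)) =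
      lam / (2 * Lf) * (A ^ 2 * (q ^ 2 - 1) + 2 * Ls * (A + Ls) * (q ^ 2 - q)) := by
    rw [hA]; field_simp
  have e2 : (Lf * (1 + sweepKappa Lf Ls T + ‖x₀‖) + Ls) ^ 2 * (lam * (q ^ 2 - 1) / (2 * Lf)) =
      lam / (2 * Lf) * ((A + k + Ls) ^ 2 * (q ^ 2 - 1)) := by
    rw [hA]; simp only [k]; ring
  rw [e1, e2]
  refine mul_le_mul_of_nonneg_left ?_ (by positivity)
  -- κ is large enough that k + L_s ≥ L_s(q² + 1)/2 ≥ L_s q. After cancelling A²(q² - 1), both sides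
  -- contain the factor q - 1, and `h2` is the quotient inequality.
  have hk2 : (q ^ 2 - 1) * (Ls / 2) ≤ k := by
    rw [hkap]
    exact mul_le_mul (by gcongr) (by linarith) (by positivity) (by nlinarith)
  have hk0 : Ls * q ≤ k + Ls := by nlinarith [sq_nonneg (q - 1)]
  have h2 : 2 * Ls * (A + Ls) * q ≤ ((k + Ls) ^ 2 + 2 * A * (k + Ls)) * (q + 1) := by
    have h3 : 0 ≤ k := mul_nonneg hL.le hk
    have h4 : 2 * A * (Ls * q) ≤ 2 * A * (k + Ls) := by gcongr
    have h5 : (Ls * q) ^ 2 ≤ (k + Ls) ^ 2 := by gcongr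
    have h6 : 2 * Ls ^ 2 * q ≤ (Ls * q) ^ 2 * (q + 1) := by
      have : 0 ≤ Ls ^ 2 * q * (q * (q + 1) - 2) := mul_nonneg (by positivity) (by nlinarith)
      linarith
    have h7 : (Ls * q) ^ 2 * (q + 1) ≤ (k + Ls) ^ 2 * (q + 1) := by gcongr
    have h8 : 0 ≤ 2 * A * (k + Ls) * q := by positivity
    linarith
  have h9 := mul_le_mul_of_nonneg_right h2 (sub_nonneg.2 hq)
  linarith

theorem norm_sub_le_sqrt_exp (D : SweepingData f S T Lf Ls) (hlam : 0 < lam) {x₀ : Euc n}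
    (hx₀ : x₀ ∈ S 0) {x y : ℝ → Euc n} (hx : IsSweepingSolution f S T x₀ x)
    (hy : IsRegularizedSolution f S T lam x₀ y) (ht : t ∈ Icc 0 T) :
    ‖y t - x t‖ ≤ (sweepC1 Lf Ls T + Lf * Real.exp (2 * Lf * T) * ‖x₀‖) *
      √(lam * (Real.exp (Lf * t) - 1) / (2 * Lf)) := by
  have hL := D.Lf_pos
  have hs := D.Ls_nonneg
  have hk := sweepKappa_nonneg hL hs (ht.1.trans ht.2)
  rw [sweepC1]
  refine norm_sub_le_sqrt_of_sq_le (by positivity)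
    ((norm_sq_sub_le_linear D hlam hx₀ hx hy ht).trans ?_)
  rw [exp_two_mul_mul]
  have hq : 1 ≤ Real.exp (Lf * t) := Real.one_le_exp (mul_nonneg hL.le ht.1)
  have hqQ : Real.exp (Lf * t) ≤ Real.exp (Lf * T) :=
    Real.exp_le_exp.2 (mul_le_mul_of_nonneg_left ht.2 hL.le)
  have hkap := mul_sweepKappa (Ls := Ls) (T := T) hL
  have hlt := Real.add_one_le_exp (Lf * t)
  set q := Real.exp (Lf * t)
  set Q := Real.exp (Lf * T)
  set M := Lf * (1 + sweepKappa Lf Ls T) + Ls + Lf * Q ^ 2 * ‖x₀‖ with hM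
  have hQ2 : q ≤ Q ^ 2 := by nlinarith
  -- By the definition of κ, M = L_f Q²(1+|x₀|) + L_s(Q² + 1)/2, while q ≤ Q ≤ (Q² + 1)/2.
  have hqM : q * (Lf * (1 + ‖x₀‖) + Ls) ≤ M := by
    have h1 := mul_le_mul_of_nonneg_right hQ2 (show 0 ≤ Lf * (1 + ‖x₀‖) by positivity)
    have h2 : q * Ls ≤ (Q ^ 2 + 1) / 2 * Ls :=
      mul_le_mul_of_nonneg_right (by nlinarith [sq_nonneg (Q - 1)]) hs
    linarith
  have h3 : (q * (Lf * (1 + ‖x₀‖) + Ls)) ^ 2 ≤ M ^ 2 := by gcongr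
  have h4 : (q * (Lf * (1 + ‖x₀‖) + Ls)) ^ 2 * (Lf * t) ≤ M ^ 2 * (q - 1) :=
    mul_le_mul h3 (by linarith) (mul_nonneg hL.le ht.1) (sq_nonneg M)
  have h5 := mul_le_mul_of_nonneg_left h4 (show 0 ≤ lam / (2 * Lf) by positivity)
  calc _ = lam / (2 * Lf) * ((q * (Lf * (1 + ‖x₀‖) + Ls)) ^ 2 * (Lf * t)) := by field_simp
    _ ≤ _ := h5
    _ = _ := by ring

/-- The flow is arbitrary off S(0), but it is Lipschitz on this closed set of full measure. Without
measurability `Measure.map` would be zero. -/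
theorem IsSweepingFlow.aemeasurable (D : SweepingData f S T Lf Ls) {X : ℝ → Euc n → Euc n}
    (hX : IsSweepingFlow f S T X) {μ : Measure (Euc n)} (hμ : μ (S 0)ᶜ = 0) (ht : t ∈ Icc 0 T) :
    AEMeasurable (X t) μ := by
  have hlip : ∀ x ∈ S 0, ∀ y ∈ S 0, ‖X t x - X t y‖ ≤ Real.exp (Lf * t) * ‖x - y‖ := by
    intro x hx y hy
    have := IsSweepingSolution.norm_sub_le D (hX x hx) (hX y hy) ht
    exact this
  exact aemeasurable_of_continuousOn_closed (D.closed 0 (left_mem_Icc.2 (ht.1.trans ht.2)))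
    (continuousOn_of_norm_sub_le (Real.exp_pos _).le hlip) hμ

theorem IsRegularizedFlow.aemeasurable (D : SweepingData f S T Lf Ls) (hlam : 0 < lam)
    {X : ℝ → Euc n → Euc n} (hX : IsRegularizedFlow f S T lam X) {μ : Measure (Euc n)}
    (hμ : μ (S 0)ᶜ = 0) (ht : t ∈ Icc 0 T) : AEMeasurable (X t) μ := by
  have hlip : ∀ x ∈ S 0, ∀ y ∈ S 0, ‖X t x - X t y‖ ≤ Real.exp (Lf * t) * ‖x - y‖ := by
    intro x hx y hy
    have := IsRegularizedSolution.norm_sub_le D hlam ⟨x, hx⟩ (hX x hx) (hX y hy) ht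
    exact this
  exact aemeasurable_of_continuousOn_closed (D.closed 0 (left_mem_Icc.2 (ht.1.trans ht.2)))
    (continuousOn_of_norm_sub_le (Real.exp_pos _).le hlip) hμ

end Rates

theorem mainTheorem3 (n : ℕ) (T Lf Ls : ℝ)
    (f : ℝ → Euc n → Euc n) (S : ℝ → Set (Euc n))
    (hLf : 0 < Lf) (hLs : 0 ≤ Ls)
    (hgrowth : ∀ t ∈ Icc 0 T, ∀ x, ‖f t x‖ ≤ Lf * (1 + ‖x‖))
    (hlip : ∀ t ∈ Icc 0 T, ∀ x₁ x₂, ‖f t x₁ - f t x₂‖ ≤ Lf * ‖x₁ - x₂‖)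
    (hclosed : ∀ t ∈ Icc 0 T, IsClosed (S t))
    (hconvex : ∀ t ∈ Icc 0 T, Convex ℝ (S t))
    (hhausdorff : ∀ t ∈ Icc 0 T, ∀ s ∈ Icc 0 T,
      Metric.hausdorffEDist (S t) (S s) ≤ ENNReal.ofReal (Ls * |t - s|))
    (X : ℝ → Euc n → Euc n) (hX : IsSweepingFlow f S T X)
    (lam : ℝ) (hlam : 0 < lam)
    (Xlam : ℝ → Euc n → Euc n) (hXlam : IsRegularizedFlow f S T lam Xlam)
    (μ₀ : Measure (Euc n)) [IsProbabilityMeasure μ₀] (hμ₀ : μ₀ (S 0)ᶜ = 0)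
    (t : ℝ) (ht : t ∈ Icc 0 T) :
    (∀ x₀ ∈ S 0, ‖Xlam t x₀ - X t x₀‖ ≤
      (Lf * (1 + sweepKappa Lf Ls T + ‖x₀‖) + Ls) *
        √(lam * (Real.exp (2 * Lf * t) - 1) / (2 * Lf))) ∧
    wasserstein1 (μ₀.map (X t)) (μ₀.map (Xlam t)) ≤
      (ENNReal.ofReal (sweepC1 Lf Ls T) + ENNReal.ofReal Lf * ∫⁻ x₀, ‖x₀‖ₑ ∂μ₀) *
        ENNReal.ofReal √(lam * (Real.exp (2 * Lf * t) - 1) / (2 * Lf)) ∧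
    wasserstein1 (μ₀.map (X t)) (μ₀.map (Xlam t)) ≤
      (ENNReal.ofReal (sweepC1 Lf Ls T) +
        ENNReal.ofReal (Lf * Real.exp (2 * Lf * T)) * ∫⁻ x₀, ‖x₀‖ₑ ∂μ₀) *
        ENNReal.ofReal √(lam * (Real.exp (Lf * t) - 1) / (2 * Lf)) := by
  have D : SweepingData f S T Lf Ls := ⟨hLf, hLs, hgrowth, hlip, hclosed, hconvex, hhausdorff⟩
  have h0 : (0 : ℝ) ∈ Icc 0 T := left_mem_Icc.2 (ht.1.trans ht.2)
  have hk := sweepKappa_nonneg hLf hLs h0.2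
  have hC1 : 0 ≤ sweepC1 Lf Ls T := by rw [sweepC1]; positivity
  have hF : AEMeasurable (X t) μ₀ := hX.aemeasurable D hμ₀ ht
  have hG : AEMeasurable (Xlam t) μ₀ := hXlam.aemeasurable D hlam hμ₀ ht
  have h1 : ∀ x₀ ∈ S 0, ‖Xlam t x₀ - X t x₀‖ ≤
      (Lf * (1 + sweepKappa Lf Ls T + ‖x₀‖) + Ls) *
        √(lam * (Real.exp (2 * Lf * t) - 1) / (2 * Lf)) := by
    intro x₀ hx₀
    have := norm_sub_le_sqrt_exp_two_mul D hlam hx₀ (hX x₀ hx₀) (hXlam x₀ hx₀) ht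
    exact this
  refine ⟨h1, ?_, ?_⟩
  · refine wasserstein1_map_le_of_norm_sub_le hμ₀ hF hG hC1 hLf.le fun x₀ hx₀ =>
      (h1 x₀ hx₀).trans_eq ?_
    rw [sweepC1]; ring
  · refine wasserstein1_map_le_of_norm_sub_le hμ₀ hF hG hC1 (by positivity) fun x₀ hx₀ => ?_
    have := norm_sub_le_sqrt_exp D hlam hx₀ (hX x₀ hx₀) (hXlam x₀ hx₀) ht
    exact this
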